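/- Let $\mathbb{F}_q$ be a finite field with $q$ elements, let $\sigma\in\mathbb{F}_q^{*}$, and let $n\ge 1$ be an integer. The number of monic irreducible polynomials $g\in\mathbb{F}_q[x]$ of degree $2n$ which satisfy $x^{2n}\cdot g(\sigma/x)=\sigma^n g(x)$ equals \[ \frac{1}{2n}\Bigl(-\delta+\sum_{d\mid n,\ d\ \text{odd}}\mu(d)\,q^{n/d}\Bigr), \] where $\mu$ is the Möbius function and \[ \delta=\begin{cases} 1 & \text{if $q$ is odd and $n>1$ is a power of $2$,}\\ 1 & \text{if $q$ is odd, $n=1$, and $\sigma$ is a square in $\mathbb{F}_q$,}\\ -1 & \text{if $q$ is odd, $n=1$, and $\sigma$ is not a square in $\mathbb{F}_q$,}\\ 0 & \text{otherwise.} \end{cases} \] -/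

import Mathlib

/-- The correction term `δ` (with `q` the size of the finite field `F`): it is `1` if `q` is odd and
`n > 1` is a power of `2`, or if `q` is odd, `n = 1` and `σ` is a square in `F`; it is `-1` if `q`
is odd, `n = 1` and `σ` is not a square in `F`; and it is `0` otherwise. -/
noncomputable def delta {F : Type*} [Field F] [Fintype F] (n : ℕ) (σ : F) : ℤ :=
  open scoped Classical in
  if Odd (Fintype.card F) ∧ 1 < n ∧ ∃ k : ℕ, n = 2 ^ k then 1
  else if Odd (Fintype.card F) ∧ n = 1 ∧ IsSquare σ then 1
  else if Odd (Fintype.card F) ∧ n = 1 ∧ ¬ IsSquare σ then -1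
  else 0

/-- The set of monic irreducible polynomials `g` of degree `2n` over `F` which satisfy
`x ^ (2n) * g (σ / x) = σ ^ n * g (x)`, an identity in the field `F(x)` of rational functions. -/
def invariantIrreducibles (F : Type*) [Field F] (n : ℕ) (σ : F) : Set (Polynomial F) :=
  {g | g.Monic ∧ Irreducible g ∧ g.natDegree = 2 * n ∧
    (RatFunc.X : RatFunc F) ^ (2 * n) * Polynomial.aeval (RatFunc.C σ / RatFunc.X) g =
      RatFunc.C σ ^ n * Polynomial.aeval (RatFunc.X : RatFunc F) g}

open Polynomial

/-! Let `q` be the size of `F`. A monic irreducible `g` of degree `2n` is invariant exactly when its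
roots satisfy `x ^ q ^ n * x = σ`: inversion `x ↦ σ / x` then acts on them as the `n`-th power of
Frobenius (`inversionTransform_eq_iff`). So one counts solutions of `x ^ (q ^ n + 1) = σ` in an
algebraic closure; there are `q ^ n + 1`.

Solutions with `x ^ 2 = σ` are those fixed by the `n`-th power of Frobenius; there are `1 + ε` of
them, `ε` being `squareRootExcess`. Any other solution has degree `2m` with `n / m` odd and already
solves the equation for `m` (`natDegree_minpoly_of_sq_ne`). Writing `N m` for the number of
invariant irreducibles of degree `2m`, this gives `q ^ n - ε = ∑ 2m * N m` over `m ∣ n` with `n / m`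
odd. Möbius inversion over odd divisors yields the formula. As `ε` depends on `n` only through
parity, it survives only when `n` is a power of `2`, and there it is `δ`. -/

/-! ### Inversion `x ↦ σ / x` on polynomials. -/

/-- The polynomial `X ^ N * g (σ / X)`. -/
noncomputable def inversionTransform {F : Type*} [Field F] (σ : F) (N : ℕ) (g : F[X]) : F[X] :=
  reflect N (g.comp (C σ * X))

theorem natDegree_comp_C_mul_X_le {F : Type*} [Field F] (σ : F) {N : ℕ} {g : F[X]}
    (hg : g.natDegree ≤ N) : (g.comp (C σ * X)).natDegree ≤ N := by
  refine natDegree_comp_le.trans ?_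
  calc _ ≤ g.natDegree * 1 :=
        Nat.mul_le_mul_left _ ((natDegree_C_mul_le σ X).trans natDegree_X_le)
    _ ≤ N := by simpa using hg

/-- Used with `L = F(x)` to move the defining identity into `F[X]`, and with `L` algebraically
closed to let inversion act on roots. -/
theorem aeval_inversionTransform {F L : Type*} [Field F] [Field L] [Algebra F L] (σ : F) {N : ℕ}
    {g : F[X]} (hg : g.natDegree ≤ N) {x : L} (hx : x ≠ 0) :
    aeval x (inversionTransform σ N g) = x ^ N * aeval (algebraMap F L σ / x) g := by
  have hdeg := natDegree_comp_C_mul_X_le σ hg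
  let : Invertible x⁻¹ := invertibleOfNonzero (inv_ne_zero hx)
  have h := eval₂_reflect_mul_pow (algebraMap F L) x⁻¹ N _ hdeg
  have h2 : (⅟(x⁻¹) : L) = x := by simp
  rw [h2, ← aeval_def, ← aeval_def, aeval_comp] at h
  have h3 : aeval x⁻¹ (C σ * X) = algebraMap F L σ / x := by simp [div_eq_mul_inv]
  rw [h3] at h
  rw [← h, inversionTransform, mul_comm _ (x⁻¹ ^ N), ← mul_assoc, ← mul_pow, mul_inv_cancel₀ hx,
    one_pow, one_mul]

theorem natDegree_inversionTransform_le {F : Type*} [Field F] (σ : F) {N : ℕ}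
    {g : F[X]} (hg : g.natDegree ≤ N) : (inversionTransform σ N g).natDegree ≤ N := by
  have hdeg := natDegree_comp_C_mul_X_le σ hg
  exact natDegree_reflect_le.trans (max_le le_rfl hdeg)

theorem mem_invariantIrreducibles_iff {F : Type*} [Field F] {n : ℕ} {σ : F} {g : F[X]} :
    g ∈ invariantIrreducibles F n σ ↔ g.Monic ∧ Irreducible g ∧ g.natDegree = 2 * n ∧
      inversionTransform σ (2 * n) g = C (σ ^ n) * g := by
  refine and_congr_right fun _ ↦ and_congr_right fun _ ↦ and_congr_right fun hdeg ↦ ?_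
  rw [← RatFunc.algebraMap_eq_C, ← aeval_inversionTransform σ hdeg.le RatFunc.X_ne_zero]
  have key (p : F[X]) : aeval (RatFunc.X : RatFunc F) p = algebraMap F[X] (RatFunc F) p := by
    rw [← RatFunc.algebraMap_X, aeval_algebraMap_apply, aeval_X_left_apply]
  have h2 : algebraMap F (RatFunc F) σ ^ n * aeval (RatFunc.X : RatFunc F) g =
      aeval (RatFunc.X : RatFunc F) (C (σ ^ n) * g) := by simp
  rw [h2, key, key, (RatFunc.algebraMap_injective F).eq_iff]

/-! ### Frobenius orbits and degrees over a finite field. -/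

section Frobenius

variable {F K : Type*} [Field F] [Fintype F] [Field K] [Algebra F K]

local notation "q" => Fintype.card F

theorem pow_card_pow_injective (k : ℕ) : Function.Injective fun x : K ↦ x ^ q ^ k := by
  have h := Function.Injective.iterate (f := ⇑(FiniteField.frobeniusAlgHom F K))
    (RingHom.injective _) k
  rwa [FiniteField.coe_frobeniusAlgHom, pow_iterate] at h

theorem aeval_pow_card_pow (g : F[X]) (x : K) (k : ℕ) :
    aeval (x ^ q ^ k) g = aeval x g ^ q ^ k := by
  have h (y : K) : (FiniteField.frobeniusAlgHom F K ^ k) y = y ^ q ^ k := by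
    rw [AlgHom.coe_pow, FiniteField.coe_frobeniusAlgHom, pow_iterate]
  rw [← h, ← h, aeval_algHom_apply]

theorem algebraMap_pow_card_pow (a : F) (k : ℕ) :
    algebraMap F K a ^ q ^ k = algebraMap F K a := by
  rw [← map_pow, FiniteField.pow_card_pow]

theorem pow_card_pow_eq_self_iff {x : K} (hx : IsIntegral F x) (k : ℕ) :
    x ^ q ^ k = x ↔ (minpoly F x).natDegree ∣ k := by
  rw [(minpoly.irreducible hx).natDegree_dvd_iff_dvd_X_pow_card_pow_sub_X, Nat.card_eq_fintype_card,
    minpoly.dvd_iff]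
  simp [sub_eq_zero]

/-- The conjugates of an element over a finite field are its images under powers of Frobenius. -/
theorem exists_eq_pow_card_pow {x y : K} (hx : IsIntegral F x) (hy : aeval y (minpoly F x) = 0) :
    ∃ j < (minpoly F x).natDegree, y = x ^ q ^ j := by
  classical
  set e := (minpoly F x).natDegree with he
  -- The `e` Frobenius images are distinct roots of a polynomial of degree `e`, so they are all its
  -- roots.
  have hinj : Set.InjOn (fun j ↦ x ^ q ^ j) (Finset.range e : Set ℕ) := by
    have aux (i j : ℕ) (hij : i ≤ j) (hj : j < e) (h : x ^ q ^ i = x ^ q ^ j) : i = j := by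
      have h1 : x ^ q ^ (j - i) = x := by
        apply pow_card_pow_injective (F := F) i
        simp only
        rw [← pow_mul, ← pow_add, Nat.sub_add_cancel hij, h]
      have h2 := Nat.eq_zero_of_dvd_of_lt ((pow_card_pow_eq_self_iff hx _).1 h1) (by omega)
      omega
    intro i hi j hj h
    simp only [Finset.coe_range, Set.mem_Iio] at hi hj
    rcases le_total i j with hij | hij
    · exact aux i j hij hj h
    · exact (aux j i hij hi h.symm).symm
  have h0 : minpoly F x ≠ 0 := minpoly.ne_zero hx
  have hsub : (Finset.range e).image (fun j ↦ x ^ q ^ j) ⊆ ((minpoly F x).aroots K).toFinset := by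
    intro z hz
    obtain ⟨j, -, rfl⟩ := Finset.mem_image.1 hz
    rw [Multiset.mem_toFinset, mem_aroots]
    refine ⟨h0, ?_⟩
    rw [aeval_pow_card_pow, minpoly.aeval, zero_pow (pow_ne_zero _ Fintype.card_ne_zero)]
  have hcard : ((minpoly F x).aroots K).toFinset.card ≤
      ((Finset.range e).image (fun j ↦ x ^ q ^ j)).card := by
    rw [Finset.card_image_of_injOn hinj, Finset.card_range]
    refine (Multiset.toFinset_card_le _).trans ((card_roots' _).trans ?_)
    rw [natDegree_map]
  have hmem : y ∈ ((minpoly F x).aroots K).toFinset := by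
    rw [Multiset.mem_toFinset, mem_aroots]
    exact ⟨h0, hy⟩
  rw [← Finset.eq_of_subset_of_card_le hsub hcard] at hmem
  obtain ⟨j, hj, rfl⟩ := Finset.mem_image.1 hmem
  exact ⟨j, Finset.mem_range.1 hj, rfl⟩

end Frobenius

/-! ### Invariance in terms of the equation `x ^ q ^ n * x = σ`. -/

section Inversion

variable {F K : Type*} [Field F] [Fintype F] [Field K] [Algebra F K]

local notation "q" => Fintype.card F

variable {σ : F} {n : ℕ} {x y : K}

theorem pow_card_pow_mul_self_of_conjugate (h : x ^ q ^ n * x = algebraMap F K σ)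
    (hy : aeval y (minpoly F x) = 0) : y ^ q ^ n * y = algebraMap F K σ := by
  have h1 : minpoly F x ∣ X ^ q ^ n * X - C σ := minpoly.dvd _ _ (by simp [h])
  have h2 := aeval_eq_zero_of_dvd_aeval_eq_zero h1 hy
  simpa [sub_eq_zero] using h2

theorem ne_zero_of_pow_card_pow_mul_self (hσ : σ ≠ 0) (h : x ^ q ^ n * x = algebraMap F K σ) :
    x ≠ 0 := by
  rintro rfl
  rw [mul_zero] at h
  exact hσ ((map_eq_zero (algebraMap F K)).1 h.symm)

theorem sq_eq_iff_pow_card_pow_eq_self (hσ : σ ≠ 0) (h : x ^ q ^ n * x = algebraMap F K σ) :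
    x ^ 2 = algebraMap F K σ ↔ x ^ q ^ n = x := by
  rw [← h, sq, mul_left_inj' (ne_zero_of_pow_card_pow_mul_self hσ h), eq_comm]

theorem pow_card_pow_two_mul_eq_self (hσ : σ ≠ 0) (h : x ^ q ^ n * x = algebraMap F K σ) :
    x ^ q ^ (2 * n) = x := by
  have h1 := congrArg (· ^ q ^ n) h
  simp only [algebraMap_pow_card_pow, mul_pow] at h1
  rw [← pow_mul x (q ^ n) (q ^ n), ← pow_add q, ← two_mul] at h1
  rw [← h, mul_comm (x ^ q ^ n) x] at h1
  exact mul_right_cancel₀ (pow_ne_zero _ (ne_zero_of_pow_card_pow_mul_self hσ h)) h1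

theorem pow_pow_mul_of_eq_self {M : Type*} [Monoid M] {x : M} {b k : ℕ} (h : x ^ b ^ k = x)
    (t : ℕ) : x ^ b ^ (k * t) = x := by
  induction t with
  | zero => simp
  | succ t ih => rw [mul_add, mul_one, pow_add, pow_mul, ih, h]

theorem pow_pow_mul_odd {M : Type*} [Monoid M] {x : M} {b m c : ℕ} (hc : Odd c)
    (h : x ^ b ^ (2 * m) = x) : x ^ b ^ (m * c) = x ^ b ^ m := by
  obtain ⟨t, rfl⟩ := hc
  rw [show m * (2 * t + 1) = 2 * m * t + m by ring, pow_add, pow_mul,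
    pow_pow_mul_of_eq_self h]

/-- The degree divides `2n` but not `n`, so it is even, say `2m`, and `c = n / m` is odd. Since `x ^
q ^ (2 * m) = x`, the powers `n = m * c` and `m` of Frobenius agree on `x`. -/
theorem natDegree_minpoly_of_sq_ne (hx : IsIntegral F x) (hσ : σ ≠ 0)
    (h : x ^ q ^ n * x = algebraMap F K σ) (hsq : x ^ 2 ≠ algebraMap F K σ) :
    ∃ m c, n = m * c ∧ Odd c ∧ (minpoly F x).natDegree = 2 * m ∧
      x ^ q ^ m * x = algebraMap F K σ := by
  rw [Ne, sq_eq_iff_pow_card_pow_eq_self hσ h, pow_card_pow_eq_self_iff hx] at hsq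
  have h2 := (pow_card_pow_eq_self_iff hx _).1 (pow_card_pow_two_mul_eq_self hσ h)
  have heven : Even (minpoly F x).natDegree := by
    by_contra ho
    rw [Nat.not_even_iff_odd] at ho
    exact hsq (Nat.Coprime.dvd_of_dvd_mul_left (Nat.coprime_two_right.2 ho) h2)
  obtain ⟨m, hm⟩ := heven.two_dvd
  rw [hm] at h2 hsq
  obtain ⟨c, rfl⟩ := Nat.dvd_of_mul_dvd_mul_left two_pos h2
  have hc : Odd c := by
    rw [← Nat.not_even_iff_odd]
    rintro hc
    obtain ⟨t, rfl⟩ := hc.two_dvd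
    exact hsq ⟨t, by ring⟩
  refine ⟨m, c, rfl, hc, hm, ?_⟩
  rwa [← pow_pow_mul_odd hc ((pow_card_pow_eq_self_iff hx _).2 hm.dvd)]

theorem pow_card_pow_mul_odd_mul_self {m c : ℕ} (hc : Odd c) (hσ : σ ≠ 0)
    (h : x ^ q ^ m * x = algebraMap F K σ) : x ^ q ^ (m * c) * x = algebraMap F K σ := by
  rw [pow_pow_mul_odd hc (pow_card_pow_two_mul_eq_self hσ h), h]

theorem sq_ne_of_natDegree_minpoly (hx : IsIntegral F x) {m : ℕ} (hm : 0 < m)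
    (hσ : σ ≠ 0) (hdeg : (minpoly F x).natDegree = 2 * m)
    (h : x ^ q ^ m * x = algebraMap F K σ) : x ^ 2 ≠ algebraMap F K σ := by
  rw [Ne, sq_eq_iff_pow_card_pow_eq_self hσ h, pow_card_pow_eq_self_iff hx, hdeg]
  intro hd
  have := Nat.le_of_dvd hm hd
  omega

/-- Over a finite field, no polynomial of degree two with a root whose square is `σ` is invariant
under the inversion `x ↦ σ / x` with multiplier `σ`. -/
theorem sq_ne_of_inversionTransform_eq (hσ : σ ≠ 0) (hn : 0 < n) {g : F[X]} (hg : g.Monic)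
    (hirr : Irreducible g) (hdeg : g.natDegree = 2 * n)
    (hinv : inversionTransform σ (2 * n) g = C (σ ^ n) * g) (hx : aeval x g = 0) :
    x ^ 2 ≠ algebraMap F K σ := by
  intro hsq
  have hdvd : g ∣ X ^ 2 - C σ := by
    rw [minpoly.eq_of_irreducible_of_monic hirr hx hg]
    exact minpoly.dvd _ _ (by simp [hsq])
  have hmon : (X ^ 2 - C σ : F[X]).Monic := monic_X_pow_sub_C σ two_ne_zero
  have hd2 : (X ^ 2 - C σ : F[X]).natDegree = 2 := natDegree_X_pow_sub_C
  have hle := natDegree_le_of_dvd hdvd hmon.ne_zero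
  obtain rfl : n = 1 := by omega
  have hgeq : X ^ 2 - C σ = g := eq_of_monic_of_dvd_of_natDegree_le hg hmon hdvd (by omega)
  subst hgeq
  -- Reflection moves the constant term `-σ` to degree `2`, where invariance demands `σ`. Hence `2 =
  -- 0` in `F`, and `X ^ 2 - C σ` is inseparable, impossible for an irreducible polynomial over a
  -- finite field.
  have hc := congrArg (fun p ↦ coeff p 2) hinv
  have h2 : (2 : F) = 0 := by
    have hr : revAt (2 * 1) 2 = 0 := revAt_le le_rfl
    simp only [inversionTransform, coeff_reflect, hr, coeff_C_mul, coeff_zero_eq_eval_zero] at hc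
    simp at hc
    have : 2 * σ = 0 := by linear_combination -hc
    exact (mul_eq_zero.1 this).resolve_right hσ
  have hsep := PerfectField.separable_of_irreducible hirr
  have hder : derivative (X ^ 2 - C σ : F[X]) = 0 := by
    rw [derivative_sub, derivative_C, derivative_X_pow]
    simp [h2]
  rw [separable_def, hder, isCoprime_zero_right] at hsep
  exact hirr.not_isUnit hsep

theorem inversionTransform_eq_iff (hσ : σ ≠ 0) (hn : 0 < n) [IsAlgClosed K] {g : F[X]}
    (hg : g.Monic) (hirr : Irreducible g) (hdeg : g.natDegree = 2 * n) (hx : aeval x g = 0) :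
    inversionTransform σ (2 * n) g = C (σ ^ n) * g ↔ x ^ q ^ n * x = algebraMap F K σ := by
  have hmin := minpoly.eq_of_irreducible_of_monic hirr hx hg
  have hint : IsIntegral F x := ⟨g, hg, hx⟩
  have hmd : (minpoly F x).natDegree = 2 * n := by rw [← hmin, hdeg]
  have hx0 : x ≠ 0 := by
    rintro rfl
    rw [minpoly.zero, natDegree_X] at hmd
    omega
  have hσK : algebraMap F K σ ≠ 0 := by simpa using hσ
  constructor
  · intro hinv
    have hsq := sq_ne_of_inversionTransform_eq hσ hn hg hirr hdeg hinv hx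
    have h1 := congrArg (aeval x) hinv
    rw [aeval_inversionTransform σ hdeg.le hx0, map_mul, hx, mul_zero, mul_eq_zero] at h1
    have hroot := h1.resolve_left (pow_ne_zero _ hx0)
    rw [hmin] at hroot
    -- Here `σ / x = x ^ q ^ j` with `j < 2n`. Inversion is an involution, so `2n ∣ 2j` and `j` is
    -- `0` or `n`; the value `0` would give `x ^ 2 = σ`.
    obtain ⟨j, hj, hjx⟩ := exists_eq_pow_card_pow hint hroot
    have h2 : x ^ q ^ j * x = algebraMap F K σ := by
      rw [← hjx, div_mul_cancel₀ _ hx0]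
    have h3 := (pow_card_pow_eq_self_iff hint _).1 (pow_card_pow_two_mul_eq_self hσ h2)
    rw [hmd] at h3 hj
    obtain ⟨c, rfl⟩ := Nat.dvd_of_mul_dvd_mul_left two_pos h3
    have hc : c < 2 := by nlinarith
    interval_cases c
    · refine absurd ?_ hsq
      simpa [sq] using h2
    · simpa using h2
  · intro h
    have hroot : aeval x (inversionTransform σ (2 * n) g) = 0 := by
      rw [aeval_inversionTransform σ hdeg.le hx0, ← h, mul_div_cancel_right₀ _ hx0,
        aeval_pow_card_pow, hx, zero_pow (pow_ne_zero _ Fintype.card_ne_zero), mul_zero]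
    have hdvd : g ∣ inversionTransform σ (2 * n) g := by
      rw [hmin]
      nth_rw 2 [← hmin]
      exact minpoly.dvd _ _ hroot
    obtain ⟨p, hp⟩ := hdvd
    have hp0 : p.natDegree = 0 := by
      by_cases h0 : p = 0
      · simp [h0]
      have h1 := natDegree_inversionTransform_le σ hdeg.le
      rw [hp, natDegree_mul hirr.ne_zero h0, hdeg] at h1
      omega
    obtain ⟨c, rfl⟩ := natDegree_eq_zero.1 hp0
    -- The constant quotient is found by evaluating at a fixed point `s` of inversion, where the
    -- factor `s ^ (2 * n)` is `σ ^ n`. This needs `g` not to vanish at `s`: its roots have degree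
    -- `2n`, so none squares to `σ`.
    obtain ⟨s, hs⟩ := IsAlgClosed.exists_pow_nat_eq (algebraMap F K σ) two_pos
    have hs0 : s ≠ 0 := by
      rintro rfl
      exact hσK (by simpa using hs.symm)
    have hgs : aeval s g ≠ 0 := by
      intro h0
      have hmin' := minpoly.eq_of_irreducible_of_monic hirr h0 hg
      have hconj : aeval s (minpoly F x) = 0 := by rw [← hmin, h0]
      refine sq_ne_of_natDegree_minpoly ⟨g, hg, h0⟩ hn hσ (by rw [← hmin', hdeg])
        (pow_card_pow_mul_self_of_conjugate h hconj) hs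
    have h4 := aeval_inversionTransform σ hdeg.le hs0
    rw [← hs, sq s, mul_div_cancel_right₀ _ hs0, hp, map_mul, aeval_C, pow_mul, hs, mul_comm,
      mul_left_inj' hgs, ← map_pow, (algebraMap F K).injective.eq_iff] at h4
    rw [hp, h4, mul_comm]

end Inversion

/-! ### Counting solutions and sorting them by degree. -/

theorem ncard_rootSet_of_separable {F K : Type*} [Field F] [Field K] [Algebra F K] [IsAlgClosed K]
    {g : F[X]} (hg : g.Separable) :
    (g.rootSet K).ncard = g.natDegree := by
  rw [← card_rootSet_eq_natDegree hg (IsAlgClosed.splits (g.map (algebraMap F K))),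
    ← Nat.card_eq_fintype_card, Nat.card_coe_set_eq]

section Counting

variable (F : Type*) (K : Type*) [Field F] [Fintype F] [Field K] [Algebra F K]

local notation "q" => Fintype.card F

/-- The elements `x` whose image under the `n`-th power of Frobenius is `σ / x`. -/
def inversionSet (n : ℕ) (σ : F) : Set K := {x | x ^ q ^ n * x = algebraMap F K σ}

/-- The elements of `inversionSet` fixed by the `n`-th power of Frobenius. -/
def fixedInversionSet (n : ℕ) (σ : F) : Set K := {x | x ^ 2 = algebraMap F K σ ∧ x ^ q ^ n = x}

/-- The elements of `inversionSet` of exact degree `2 * n`. -/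
def primitiveInversionSet (n : ℕ) (σ : F) : Set K :=
  {x ∈ inversionSet F K n σ | (minpoly F x).natDegree = 2 * n}

variable {F K} {σ : F} {n : ℕ}

theorem inversionSet_eq_rootSet (n : ℕ) (σ : F) :
    inversionSet F K n σ = (X ^ (q ^ n + 1) - C σ : F[X]).rootSet K := by
  ext x
  rw [mem_rootSet_of_ne (monic_X_pow_sub_C σ (Nat.succ_ne_zero _)).ne_zero]
  simp [inversionSet, sub_eq_zero, pow_succ]

theorem finite_inversionSet (n : ℕ) (σ : F) : (inversionSet F K n σ).Finite := by
  rw [inversionSet_eq_rootSet]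
  exact rootSet_finite _ _

theorem finite_primitiveInversionSet (n : ℕ) (σ : F) :
    (primitiveInversionSet F K n σ).Finite :=
  (finite_inversionSet n σ).subset fun _ h ↦ h.1

/-- As `n > 0`, the exponent `q ^ n + 1` equals `1` in `F`, which makes the polynomial separable. -/
theorem ncard_inversionSet [IsAlgClosed K] (hσ : σ ≠ 0) (hn : 0 < n) :
    (inversionSet F K n σ).ncard = q ^ n + 1 := by
  have hsep : (X ^ (q ^ n + 1) - C σ : F[X]).Separable :=
    separable_X_pow_sub_C σ (by simp [hn.ne']) hσ
  rw [inversionSet_eq_rootSet, ncard_rootSet_of_separable hsep, natDegree_X_pow_sub_C]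

theorem inversionSet_diff_fixedInversionSet (hσ : σ ≠ 0) (n : ℕ) :
    inversionSet F K n σ \ fixedInversionSet F K n σ =
      {x ∈ inversionSet F K n σ | x ^ 2 ≠ algebraMap F K σ} := by
  ext x
  refine and_congr_right fun h ↦ not_congr ?_
  exact ⟨fun h1 ↦ h1.1, fun h1 ↦ ⟨h1, (sq_eq_iff_pow_card_pow_eq_self hσ h).1 h1⟩⟩

theorem fixedInversionSet_subset (n : ℕ) (σ : F) :
    fixedInversionSet F K n σ ⊆ inversionSet F K n σ := by
  rintro x ⟨h1, h2⟩
  change x ^ q ^ n * x = _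
  rw [h2, ← sq, h1]

/-- The elements of `inversionSet` which are not square roots of `σ`, sorted by degree. -/
theorem ncard_inversionSet_diff [Algebra.IsAlgebraic F K] (hσ : σ ≠ 0) (k : ℕ) {m : ℕ}
    (hm : Odd m) :
    (inversionSet F K (2 ^ k * m) σ \ fixedInversionSet F K (2 ^ k * m) σ).ncard =
      ∑ e ∈ m.divisors, (primitiveInversionSet F K (2 ^ k * e) σ).ncard := by
  classical
  have hint (x : K) : IsIntegral F x := Algebra.IsIntegral.isIntegral x
  rw [inversionSet_diff_fixedInversionSet hσ]
  have hfin : {x ∈ inversionSet F K (2 ^ k * m) σ | x ^ 2 ≠ algebraMap F K σ}.Finite :=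
    (finite_inversionSet _ σ).subset fun _ h ↦ h.1
  have h2k : 0 < 2 ^ k := by positivity
  -- The degree is `2l` with `l * c = 2 ^ k * m` and `c` odd, so `l` absorbs all of `2 ^ k`: `l = 2
  -- ^ k * e` with `e ∣ m`. The fibres are indexed by this `e`.
  have hmaps : ∀ x ∈ hfin.toFinset, (minpoly F x).natDegree / (2 * 2 ^ k) ∈ m.divisors := by
    intro x hx
    obtain ⟨hx1, hx2⟩ := hfin.mem_toFinset.1 hx
    obtain ⟨l, c, hlc, hc, hl, -⟩ := natDegree_minpoly_of_sq_ne (hint x) hσ hx1 hx2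
    have hdvd : 2 ^ k ∣ l := by
      refine Nat.Coprime.dvd_of_dvd_mul_right (k := 2 ^ k) (m := l) (n := c) ?_ ⟨m, hlc.symm⟩
      exact Nat.Coprime.pow_left _ (Nat.coprime_two_left.2 hc)
    obtain ⟨e, rfl⟩ := hdvd
    rw [hl, ← mul_assoc, Nat.mul_div_cancel_left _ (by positivity), Nat.mem_divisors]
    rw [mul_assoc] at hlc
    exact ⟨⟨c, Nat.eq_of_mul_eq_mul_left h2k hlc⟩, hm.pos.ne'⟩
  rw [Set.ncard_eq_toFinset_card _ hfin, Finset.card_eq_sum_card_fiberwise hmaps]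
  refine Finset.sum_congr rfl fun e he ↦ ?_
  rw [← Set.ncard_coe_finset]
  congr 1
  have hem := (Nat.mem_divisors.1 he).1
  have he0 : 0 < e := Nat.pos_of_mem_divisors he
  ext x
  simp only [Finset.coe_filter, Set.Finite.mem_toFinset, Set.mem_ofPred_eq]
  constructor
  · rintro ⟨⟨hx1, hx2⟩, hx3⟩
    obtain ⟨l, c, hlc, hc, hl, hS⟩ := natDegree_minpoly_of_sq_ne (hint x) hσ hx1 hx2
    have hdvd : 2 ^ k ∣ l := by
      refine Nat.Coprime.dvd_of_dvd_mul_right (k := 2 ^ k) (m := l) (n := c) ?_ ⟨m, hlc.symm⟩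
      exact Nat.Coprime.pow_left _ (Nat.coprime_two_left.2 hc)
    obtain ⟨e', rfl⟩ := hdvd
    rw [hl, ← mul_assoc, Nat.mul_div_cancel_left _ (by positivity)] at hx3
    subst hx3
    exact ⟨hS, hl⟩
  · rintro ⟨hS, hdeg⟩
    obtain ⟨c, rfl⟩ := hem
    have hc : Odd c := (Nat.odd_mul.1 hm).2
    refine ⟨⟨?_, sq_ne_of_natDegree_minpoly (hint x) (by positivity) hσ hdeg hS⟩, ?_⟩
    · change x ^ q ^ _ * x = _
      rw [← mul_assoc]
      exact pow_card_pow_mul_odd_mul_self hc hσ hS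
    · rw [hdeg, ← mul_assoc, Nat.mul_div_cancel_left _ (by positivity)]

theorem invariantIrreducibles_eq_image [IsAlgClosed K] [Algebra.IsAlgebraic F K] (hσ : σ ≠ 0)
    (hn : 0 < n) : invariantIrreducibles F n σ = minpoly F '' primitiveInversionSet F K n σ := by
  ext g
  rw [mem_invariantIrreducibles_iff]
  constructor
  · rintro ⟨hg, hirr, hdeg, hinv⟩
    obtain ⟨x, hx⟩ := IsAlgClosed.exists_aeval_eq_zero K g hirr.degree_pos.ne'
    have hmin := minpoly.eq_of_irreducible_of_monic hirr hx hg
    exact ⟨x, ⟨(inversionTransform_eq_iff hσ hn hg hirr hdeg hx).1 hinv, hmin ▸ hdeg⟩, hmin.symm⟩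
  · rintro ⟨x, ⟨hx, hdeg⟩, rfl⟩
    have hint : IsIntegral F x := Algebra.IsIntegral.isIntegral x
    have hirr := minpoly.irreducible hint
    exact ⟨minpoly.monic hint, hirr, hdeg, (inversionTransform_eq_iff hσ hn (minpoly.monic hint)
      hirr hdeg (minpoly.aeval F x)).2 hx⟩

/-- Finite fields are perfect, so each invariant irreducible is the minimal polynomial of exactly
`2n` elements. -/
theorem ncard_primitiveInversionSet [IsAlgClosed K] [Algebra.IsAlgebraic F K] (hσ : σ ≠ 0)
    (hn : 0 < n) : (primitiveInversionSet F K n σ).ncard =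
      2 * n * (invariantIrreducibles F n σ).ncard := by
  classical
  have hfin := finite_primitiveInversionSet (K := K) n σ
  have hfin' : (invariantIrreducibles F n σ).Finite := by
    rw [invariantIrreducibles_eq_image (K := K) hσ hn]
    exact hfin.image _
  have hmaps : ∀ x ∈ hfin.toFinset, minpoly F x ∈ hfin'.toFinset := by
    intro x hx
    rw [hfin'.mem_toFinset, invariantIrreducibles_eq_image (K := K) hσ hn]
    exact ⟨x, hfin.mem_toFinset.1 hx, rfl⟩
  rw [Set.ncard_eq_toFinset_card _ hfin, Finset.card_eq_sum_card_fiberwise hmaps,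
    Set.ncard_eq_toFinset_card _ hfin', mul_comm, ← smul_eq_mul]
  refine Finset.sum_const_nat fun g hg ↦ ?_
  rw [hfin'.mem_toFinset] at hg
  obtain ⟨hmon, hirr, hdeg, hinv⟩ := mem_invariantIrreducibles_iff.1 hg
  rw [← Set.ncard_coe_finset, ← hdeg,
    ← ncard_rootSet_of_separable (K := K) (PerfectField.separable_of_irreducible hirr)]
  congr 1
  ext x
  rw [mem_rootSet_of_ne hirr.ne_zero]
  simp only [Finset.coe_filter, Set.Finite.mem_toFinset, Set.mem_ofPred_eq]
  constructor
  · rintro ⟨-, rfl⟩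
    exact minpoly.aeval F x
  · intro hx
    have hmin := minpoly.eq_of_irreducible_of_monic hirr hx hmon
    exact ⟨⟨(inversionTransform_eq_iff hσ hn hmon hirr hdeg hx).1 hinv, hmin ▸ hdeg⟩, hmin.symm⟩

/-! ### Square roots of `σ` fixed by a power of Frobenius. -/

open scoped Classical in
/-- One less than the number of square roots of `σ` in the extension of `F` of degree `n`. -/
noncomputable def squareRootExcess (n : ℕ) (σ : F) : ℤ :=
  if Odd (Fintype.card F) then if Even n ∨ IsSquare σ then 1 else -1 else 0

/-- A square root of `σ` has degree at most `2`, so it is fixed by the second power of Frobenius; if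
`n` is odd and it is also fixed by the `n`-th, its degree divides `gcd(n, 2) = 1` and it lies in
`F`. -/
theorem pow_card_pow_eq_self_iff_of_sq_eq [Algebra.IsAlgebraic F K] {s : K}
    (hs : s ^ 2 = algebraMap F K σ) (hn : 0 < n) (hq : Odd q) :
    s ^ q ^ n = s ↔ Even n ∨ IsSquare σ := by
  have hint : IsIntegral F s := Algebra.IsIntegral.isIntegral s
  have h2 : s ^ q ^ 2 = s := by
    have h : (s ^ q) ^ 2 = s ^ 2 := by
      rw [← pow_mul, mul_comm, pow_mul, hs, ← map_pow, FiniteField.pow_card]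
    rw [sq q, pow_mul]
    rcases sq_eq_sq_iff_eq_or_eq_neg.1 h with h | h
    · rw [h, h]
    · rw [h, hq.neg_pow, h, neg_neg]
  constructor
  · intro h
    by_contra! hne
    rw [Nat.not_even_iff_odd] at hne
    have hd := Nat.dvd_gcd ((pow_card_pow_eq_self_iff hint _).1 h)
      ((pow_card_pow_eq_self_iff hint _).1 h2)
    rw [(Nat.coprime_two_right.2 hne.1 : n.gcd 2 = 1), Nat.dvd_one,
      minpoly.natDegree_eq_one_iff] at hd
    obtain ⟨t, rfl⟩ := hd
    rw [← map_pow, (algebraMap F K).injective.eq_iff] at hs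
    exact hne.2 ⟨t, by rw [← hs, sq]⟩
  · rintro (h | ⟨t, rfl⟩)
    · obtain ⟨c, rfl⟩ := h.two_dvd
      exact pow_pow_mul_of_eq_self h2 c
    · rw [← sq, map_pow] at hs
      rcases sq_eq_sq_iff_eq_or_eq_neg.1 hs with rfl | rfl
      · exact algebraMap_pow_card_pow t n
      · rw [← map_neg]
        exact algebraMap_pow_card_pow _ n

theorem ncard_fixedInversionSet [IsAlgClosed K] [Algebra.IsAlgebraic F K] (hσ : σ ≠ 0)
    (hn : 0 < n) : ((fixedInversionSet F K n σ).ncard : ℤ) = 1 + squareRootExcess n σ := by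
  obtain ⟨s, hs⟩ := IsAlgClosed.exists_pow_nat_eq (algebraMap F K σ) two_pos
  unfold squareRootExcess
  by_cases hq : Odd q
  · rw [if_pos hq]
    split_ifs with h
    · have hset : fixedInversionSet F K n σ = {s, -s} := by
        ext x
        constructor
        · rintro ⟨h1, -⟩
          exact sq_eq_sq_iff_eq_or_eq_neg.1 (h1.trans hs.symm)
        · intro hx
          have hx2 : x ^ 2 = algebraMap F K σ := by
            rcases hx with rfl | rfl
            · exact hs
            · rw [neg_sq, hs]
          exact ⟨hx2, (pow_card_pow_eq_self_iff_of_sq_eq hx2 hn hq).2 h⟩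
      have hne : s ≠ -s := by
        have h2 : (2 : F) ≠ 0 := Ring.two_ne_zero fun hc ↦ by
          have := FiniteField.even_card_iff_char_two.1 hc
          have := Nat.odd_iff.1 hq
          omega
        have h2K : (2 : K) ≠ 0 := by
          rw [← map_ofNat (algebraMap F K) 2]
          exact (_root_.map_ne_zero _).2 h2
        intro h0
        have h3 : 2 * s = 0 := by linear_combination h0
        rw [(mul_eq_zero.1 h3).resolve_left h2K] at hs
        exact hσ ((map_eq_zero (algebraMap F K)).1 (by simpa using hs.symm))
      rw [hset, Set.ncard_pair hne]
      norm_num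
    · have hset : fixedInversionSet F K n σ = ∅ := by
        refine Set.eq_empty_of_forall_notMem ?_
        rintro x ⟨h1, h2⟩
        exact h ((pow_card_pow_eq_self_iff_of_sq_eq h1 hn hq).1 h2)
      rw [hset]
      simp
  · rw [if_neg hq]
    have hchar : ringChar F = 2 :=
      FiniteField.even_card_iff_char_two.2 (Nat.even_iff.1 (Nat.not_odd_iff_even.1 hq))
    have : CharP F 2 := ringChar.of_eq hchar
    have : CharP K 2 := charP_of_injective_algebraMap (algebraMap F K).injective 2
    obtain ⟨t, rfl⟩ := FiniteField.isSquare_of_char_two hchar σ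
    have hset : fixedInversionSet F K n (t * t) = {algebraMap F K t} := by
      ext x
      constructor
      · rintro ⟨h1, -⟩
        rw [← sq, map_pow] at h1
        rcases sq_eq_sq_iff_eq_or_eq_neg.1 h1 with h | h
        · exact h
        · rwa [CharTwo.neg_eq] at h
      · rintro rfl
        exact ⟨by rw [← sq, map_pow], algebraMap_pow_card_pow t n⟩
    rw [hset]
    simp

/-! ### Möbius inversion over odd divisors and the correction term. -/

open ArithmeticFunction in
theorem ncard_primitiveInversionSet_eq_sum [IsAlgClosed K] [Algebra.IsAlgebraic F K] (hσ : σ ≠ 0)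
    (k : ℕ) {m : ℕ} (hm : Odd m) :
    ((primitiveInversionSet F K (2 ^ k * m) σ).ncard : ℤ) =
      ∑ d ∈ m.divisors, moebius d * ((q : ℤ) ^ (2 ^ k * m / d) -
        squareRootExcess (2 ^ k * m) σ) := by
  have hodd : ∀ a b : ℕ, a ∣ b → b ∈ {j : ℕ | Odd j} → a ∈ {j : ℕ | Odd j} :=
    fun a b hab hb ↦ Odd.of_dvd_nat hb hab
  -- With `2 ^ k` frozen and `j` odd, the parity of `2 ^ k * j` does not depend on `j`, so the
  -- excess is a constant during the inversion on the divisor-closed set of odd numbers.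
  have hparity (j : ℕ) (hj : Odd j) :
      squareRootExcess (2 ^ k * j) σ = squareRootExcess (2 ^ k * m) σ := by
    have h : Even (2 ^ k * j) ↔ Even (2 ^ k * m) := by
      simp only [Nat.even_mul, Nat.not_even_iff_odd.2 hj, Nat.not_even_iff_odd.2 hm]
    unfold squareRootExcess
    classical
    exact if_congr Iff.rfl (if_congr (or_congr_left h) rfl rfl) rfl
  have h := (sum_eq_iff_sum_smul_moebius_eq_on
    (f := fun j ↦ ((primitiveInversionSet F K (2 ^ k * j) σ).ncard : ℤ))
    (g := fun j ↦ (q : ℤ) ^ (2 ^ k * j) - squareRootExcess (2 ^ k * m) σ) _ hodd).1 ?_ m hm.pos hm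
  · rw [← h, Nat.sum_divisorsAntidiagonal (f := fun a b ↦ moebius a •
      ((q : ℤ) ^ (2 ^ k * b) - squareRootExcess (2 ^ k * m) σ))]
    refine Finset.sum_congr rfl fun d hd ↦ ?_
    rw [smul_eq_mul, Nat.mul_div_assoc _ (Nat.mem_divisors.1 hd).1]
  · intro j hj0 hj
    have hpos : 0 < 2 ^ k * j := by positivity
    rw [← Nat.cast_sum, ← ncard_inversionSet_diff hσ k hj,
      Set.ncard_sdiff (fixedInversionSet_subset _ σ)
        ((finite_inversionSet _ σ).subset (fixedInversionSet_subset _ σ)),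
      Nat.cast_sub (Set.ncard_le_ncard (fixedInversionSet_subset _ σ) (finite_inversionSet _ σ)),
      ncard_inversionSet hσ hpos, ncard_fixedInversionSet hσ hpos, hparity j hj]
    push_cast
    ring

theorem sum_divisors_moebius (m : ℕ) :
    ∑ d ∈ m.divisors, ArithmeticFunction.moebius d = if m = 1 then 1 else 0 := by
  rw [← ArithmeticFunction.coe_mul_zeta_apply, ArithmeticFunction.moebius_mul_coe_zeta,
    ArithmeticFunction.one_apply]

theorem filter_odd_divisors_two_pow_mul (k : ℕ) {m : ℕ} (hm : Odd m) :
    (2 ^ k * m).divisors.filter Odd = m.divisors := by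
  have h0 : 2 ^ k * m ≠ 0 := by have := hm.pos; positivity
  ext d
  simp only [Finset.mem_filter, Nat.mem_divisors, h0, hm.pos.ne', ne_eq, not_false_eq_true,
    and_true]
  constructor
  · rintro ⟨h, hd⟩
    exact (Nat.Coprime.pow_right k (Nat.coprime_two_right.2 hd)).dvd_of_dvd_mul_left h
  · exact fun h ↦ ⟨h.mul_left _, Odd.of_dvd_nat hm h⟩

/-- The factor `∑ μ(d)` over `d ∣ m` kills the excess unless `m = 1`. For `n = 2 ^ k > 1` the excess
no longer depends on `σ`, as `n` is even; only `n = 1` sees whether `σ` is a square. -/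
theorem delta_two_pow_mul (k : ℕ) {m : ℕ} (hm : Odd m) (σ : F) :
    delta (2 ^ k * m) σ = if m = 1 then squareRootExcess (2 ^ k * m) σ else 0 := by
  unfold delta squareRootExcess
  by_cases h1 : m = 1
  · subst h1
    rw [if_pos rfl, mul_one]
    rcases Nat.eq_zero_or_pos k with rfl | hk
    · by_cases hq : Odd q <;> by_cases hs : IsSquare σ <;> simp [hq, hs]
    · have h2 : 1 < 2 ^ k := Nat.one_lt_two_pow hk.ne'
      have h3 : Even (2 ^ k) := even_two.pow_of_ne_zero hk.ne'
      have h4 : ∃ l, 2 ^ k = 2 ^ l := ⟨k, rfl⟩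
      simp only [h2, h3, h2.ne', h4, and_true, false_and, and_false, if_false, true_or,
        if_true]
  · have h2 : 2 ^ k * m ≠ 1 := fun h ↦ h1 (Nat.eq_one_of_mul_eq_one_left h)
    have h3 : ¬ ∃ l, 2 ^ k * m = 2 ^ l := by
      rintro ⟨l, hl⟩
      have hdvd : m ∣ 2 ^ l := ⟨2 ^ k, by rw [← hl, mul_comm]⟩
      exact h1 (Nat.eq_one_of_dvd_one
        ((Nat.Coprime.pow_right l (Nat.coprime_two_right.2 hm)).dvd_of_dvd_mul_right (k := m)
          (by simpa using hdvd)))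
    simp only [h1, h2, h3, and_false, false_and, if_false]

end Counting

theorem corollary3p5 {F : Type*} [Field F] [Fintype F] (σ : F) (hσ : σ ≠ 0)
    (n : ℕ) (hn : 1 ≤ n) :
    (invariantIrreducibles F n σ).Finite ∧
    ((invariantIrreducibles F n σ).ncard : ℚ) =
      1 / (2 * (n : ℚ)) *
        (-(delta n σ : ℚ) +
          ∑ d ∈ n.divisors with Odd d,
            (ArithmeticFunction.moebius d : ℚ) * (Fintype.card F : ℚ) ^ (n / d)) := by
  refine ⟨?_, ?_⟩
  · rw [invariantIrreducibles_eq_image (K := AlgebraicClosure F) hσ hn]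
    exact (finite_primitiveInversionSet n σ).image _
  obtain ⟨k, m, hm, rfl⟩ := Nat.exists_eq_two_pow_mul_odd (Nat.one_le_iff_ne_zero.1 hn)
  have hcount := ncard_primitiveInversionSet_eq_sum (K := AlgebraicClosure F) hσ k hm
  -- The excess is independent of `d`, so it factors out of the Möbius sum and leaves `δ`.
  have hdelta : squareRootExcess (2 ^ k * m) σ * ∑ d ∈ m.divisors, ArithmeticFunction.moebius d =
      delta (2 ^ k * m) σ := by
    rw [delta_two_pow_mul k hm, sum_divisors_moebius, mul_ite, mul_one, mul_zero]
  simp only [mul_sub, Finset.sum_sub_distrib] at hcount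
  rw [ncard_primitiveInversionSet hσ hn, ← Finset.sum_mul,
    mul_comm _ (squareRootExcess _ _), hdelta] at hcount
  have hQ := congrArg (Int.cast : ℤ → ℚ) hcount
  rw [filter_odd_divisors_two_pow_mul k hm]
  have hn0 : ((2 ^ k * m : ℕ) : ℚ) ≠ 0 := by exact_mod_cast (Nat.one_le_iff_ne_zero.1 hn)
  simp only [Int.cast_sub, Int.cast_sum, Int.cast_mul, Int.cast_pow, Int.cast_natCast] at hQ
  rw [Nat.cast_mul, Nat.cast_mul 2, Nat.cast_ofNat] at hQ
  field_simp
  linear_combination hQ
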